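/- All spaces are locally compact Hausdorff. Write $K\in\mathcal K_{I}$ if $K$ is $\sigma$-compact; $K\in\mathcal K_{II}$ if $K$ is not $\sigma$-compact but has a dense $\sigma$-compact subset; $K\in\mathcal K_{III}$ if the complement of every $\sigma$-compact subset of $K$ has an interior point and some $\sigma$-compact subset of $K$ is not precompact; $K\in\mathcal K_{IV}$ if the complement of every $\sigma$-compact subset has an interior point and every $\sigma$-compact subset is precompact. The $C^*$-algebra $C_0(K)$ of complex continuous functions vanishing at infinity is regarded as a Hilbert module over itself with $\langle x,y\rangle=\bar x y$; $C_b(K)$ is the algebra of bounded continuous functions, and $\langle x,y\rangle=\bar x y\in C_0(K)$ also for $x\in C_0(K)$, $y\in C_b(K)$. An operator on $C_0(K)$ is a bounded $C_0(K)$-homomorphism $F$; it is adjointable if there is an operator $F^*$ with $\langle Fx,y\rangle=\langle x,F^*y\rangle$ for all $x,y$, and $C_0(K)$-compact if it lies in the norm closure of the linear span of the operators $\theta_{x,y}(z)=x\langle y,z\rangle$. A sequence $X=(x_i)$ in $C_b(K)$ is admissible if $\|x_i\|\le1$ for all $i$ and, for every $x\in C_0(K)$, the series $\sum_i\langle x,x_i\rangle\langle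 x_i,x\rangle$ converges in norm with sum at most $\langle x,x\rangle$. A set $Y\subseteq C_0(K)$ is $(C_b(K),C_0(K))$-totally bounded if for every admissible $X$, every sequence $\Phi=(\varphi_k)$ of states of $C_0(K)$ and every $\varepsilon>0$ there is a finite $\varepsilon$-net in $Y$ for the pseudometric $d_{X,\Phi}(x,y)=\bigl(\sup_k\sum_{i\ge k}|\varphi_k(\langle x-y,x_i\rangle)|^2\bigr)^{1/2}$. For non-compact $K$, let $\dot C_0(K)$ be the unitization of $C_0(K)$. A frame in $C_0(K)$ is a family $(x_j)_{j\in J}$ in $C_0(K)$, indexed by any set $J$, for which there are constants $c_1,c_2>0$ such that for every $x\in C_0(K)$ the series $\sum_j\langle x,x_j\rangle\langle x_j,x\rangle$ converges and $c_1\langle x,x\rangle\le\sum_j\langle x,x_j\rangle\langle x_j,x\rangle\le c_2\langle x,x\rangle$, where the convergence is either in the norm of $\dot C_0(K)$ (standard frame) or, for the net of finite partial sums, in the ultraweak topology of the universal enveloping von Neumann algebra of $\dot C_0(K)$, to an element of that algebra (non-standard frame). **Theorem.** Let $K=P_1\sqcup P_2$ with $P_1\in\mathcal K_{IV}$ and $P_2\in\mathcal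 K_{I}\cup\mathcal K_{II}\cup\mathcal K_{III}$. If $P_2$ is not compact, then $K\in\mathcal K_{III}$. Let $F:C_0(K)\to C_0(K)$ be multiplication by the indicator function of $P_1$. Then 1. $F$ is an adjointable operator; 2. $F$ is not $C_0(K)$-compact; 3. the image under $F$ of the closed unit ball of $C_0(K)$ is $(C_b(K),C_0(K))$-totally bounded; 4. $C_0(K)$ has no frames, neither standard nor non-standard. -/

import Mathlib

open Filter Topology Set
open scoped ZeroAtInfty ComplexOrder BoundedContinuousFunction InnerProductSpace CStarAlgebra ENNReal

noncomputable section

namespace CStarFrames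

/-! ### Classes of locally compact Hausdorff spaces -/

/-- `𝒦_I`: the `σ`-compact locally compact Hausdorff spaces. -/
def ClassI (K : Type*) [TopologicalSpace K] : Prop :=
  LocallyCompactSpace K ∧ T2Space K ∧ SigmaCompactSpace K

/-- `𝒦_II`: not `σ`-compact, but with a dense `σ`-compact subset. -/
def ClassII (K : Type*) [TopologicalSpace K] : Prop :=
  LocallyCompactSpace K ∧ T2Space K ∧ ¬ SigmaCompactSpace K ∧
    ∃ s : Set K, IsSigmaCompact s ∧ Dense s

/-- `𝒦_III`: the complement of every `σ`-compact subset has an interior point, and some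
`σ`-compact subset is not precompact. -/
def ClassIII (K : Type*) [TopologicalSpace K] : Prop :=
  LocallyCompactSpace K ∧ T2Space K ∧
    (∀ s : Set K, IsSigmaCompact s → (interior sᶜ).Nonempty) ∧
    ∃ s : Set K, IsSigmaCompact s ∧ ¬ IsCompact (closure s)

/-- `𝒦_IV`: the complement of every `σ`-compact subset has an interior point, and every
`σ`-compact subset is precompact. -/
def ClassIV (K : Type*) [TopologicalSpace K] : Prop :=
  LocallyCompactSpace K ∧ T2Space K ∧
    (∀ s : Set K, IsSigmaCompact s → (interior sᶜ).Nonempty) ∧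
    ∀ s : Set K, IsSigmaCompact s → IsCompact (closure s)

/-! ### A `C⋆`-algebra as a right Hilbert module over itself

The inner product is `⟨x, y⟩ = x⋆ y`, and `A` acts by multiplication from the right. -/

section Operators

variable {A : Type*} [NonUnitalCStarAlgebra A]

/-- An operator in the sense of Hilbert `C⋆`-modules: a bounded `A`-homomorphism. -/
def IsModuleOperator (F : A →L[ℂ] A) : Prop :=
  ∀ x a : A, F (x * a) = F x * a

/-- `F` is an operator which has an adjoint `G`, that is `⟨F x, y⟩ = ⟨x, G y⟩`. -/
def IsAdjointable (F : A →L[ℂ] A) : Prop :=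
  IsModuleOperator F ∧
    ∃ G : A →L[ℂ] A, IsModuleOperator G ∧ ∀ x y : A, star (F x) * y = star x * G y

/-- The elementary `A`-compact operator `θ_{x,y}(z) = x ⟨y, z⟩`. -/
def theta (x y : A) : A →L[ℂ] A :=
  ContinuousLinearMap.mul ℂ A x ∘L ContinuousLinearMap.mul ℂ A (star y)

theorem theta_apply (x y z : A) : theta x y z = x * (star y * z) := rfl

/-- `F` is `A`-compact: it lies in the operator norm closure of the linear span of the elementary
`A`-compact operators. -/
def IsACompact (F : A →L[ℂ] A) : Prop :=
  F ∈ closure (Submodule.span ℂ {T : A →L[ℂ] A | ∃ x y : A, T = theta x y} : Set (A →L[ℂ] A))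

/-- A state: a positive linear functional of norm one. -/
def IsState (φ : A →L[ℂ] ℂ) : Prop :=
  (∀ a : A, 0 ≤ φ (star a * a)) ∧ ‖φ‖ = 1

end Operators

/-! ### The universal enveloping von Neumann algebra of a unital `C⋆`-algebra -/

section Enveloping

variable (B : Type*) [CStarAlgebra B] [PartialOrder B] [StarOrderedRing B]

/-- The states of a unital `C⋆`-algebra, as positive functionals taking the value `1` at `1`. -/
abbrev UnitalState : Type _ := {f : B →ₚ[ℂ] ℂ // f 1 = 1}

/-- The space of the universal representation: the Hilbert sum of the GNS spaces of all states. -/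
abbrev UniversalSpace : Type _ := lp (fun f : UnitalState B => f.1.GNS) 2

variable {B}

/-- The direct sum of the operators by which `b` acts on the GNS spaces of all states. -/
def universalOperator (b : B) : UniversalSpace B →L[ℂ] UniversalSpace B :=
  lp.mapCLM 2 (fun f : UnitalState B => f.1.gnsStarAlgHom b) (norm_nonneg b)
    (fun f => NonUnitalStarAlgHom.norm_apply_le f.1.gnsStarAlgHom b)

theorem universalOperator_apply (b : B) (ξ : UniversalSpace B) (f : UnitalState B) :
    universalOperator b ξ f = f.1.gnsStarAlgHom b (ξ f) := rfl

/-- The universal representation: the direct sum of the GNS representations of all states. -/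
def universalRep : B →⋆ₐ[ℂ] (UniversalSpace B →L[ℂ] UniversalSpace B) where
  toFun := universalOperator
  map_one' := by ext ξ f; simp [universalOperator_apply]
  map_mul' a b := by ext ξ f; simp [universalOperator_apply]
  map_zero' := by ext ξ f; simp [universalOperator_apply]
  map_add' a b := by ext ξ f; simp [universalOperator_apply]
  commutes' r := by
    ext ξ f; simp [universalOperator_apply, Algebra.algebraMap_eq_smul_one]
  map_star' a := by
    refine (ContinuousLinearMap.eq_adjoint_iff _ _).2 fun x y => ?_
    rw [lp.inner_eq_tsum, lp.inner_eq_tsum]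
    congr 1; ext f
    rw [universalOperator_apply, universalOperator_apply, map_star]
    exact ContinuousLinearMap.adjoint_inner_left _ _ _

theorem universalRep_apply (b : B) (ξ : UniversalSpace B) (f : UnitalState B) :
    universalRep b ξ f = f.1.gnsStarAlgHom b (ξ f) := rfl

variable (B) in
/-- The universal enveloping von Neumann algebra `B''`: the bicommutant of the image of the
universal representation. -/
def envelopingAlgebra : Set (UniversalSpace B →L[ℂ] UniversalSpace B) :=
  Set.centralizer (Set.centralizer (Set.range (universalRep : B → UniversalSpace B →L[ℂ] UniversalSpace B)))

end Enveloping

/-- Convergence of a net of bounded operators in the ultraweak (`σ`-weak) topology, which is given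
by the functionals `T ↦ ∑ₙ ⟨ξₙ, T ηₙ⟩` with `∑ₙ ‖ξₙ‖² < ∞` and `∑ₙ ‖ηₙ‖² < ∞`. -/
def UltraweakTendsto {H : Type*} [NormedAddCommGroup H] [InnerProductSpace ℂ H] {ι : Type*}
    (S : ι → H →L[ℂ] H) (l : Filter ι) (T : H →L[ℂ] H) : Prop :=
  ∀ ξ η : ℕ → H, Summable (fun n => ‖ξ n‖ ^ 2) → Summable (fun n => ‖η n‖ ^ 2) →
    Tendsto (fun i => ∑' n, ⟪ξ n, S i (η n)⟫_ℂ) l (𝓝 (∑' n, ⟪ξ n, T (η n)⟫_ℂ))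

/-! ### Frames

The algebra `A` is regarded as a Hilbert module over its unitization `A⁺¹`. -/

section Frames

variable {A : Type*} [NonUnitalCStarAlgebra A] [PartialOrder A] [StarOrderedRing A]

/-- The term `⟨x, y⟩⟨y, x⟩`, as an element of the unitization. -/
def frameTerm (x y : A) : A⁺¹ := (((star x * y) * (star y * x) : A) : A⁺¹)

/-- The square `⟨x, x⟩`, as an element of the unitization. -/
def innerSelf (x : A) : A⁺¹ := ((star x * x : A) : A⁺¹)

/-- Standard frames: the series `∑ⱼ ⟨x, xⱼ⟩⟨xⱼ, x⟩` converges in norm, and its sum lies between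
`c₁⟨x, x⟩` and `c₂⟨x, x⟩`. -/
def IsStandardFrame {J : Type*} (u : J → A) : Prop :=
  ∃ c₁ c₂ : ℝ, 0 < c₁ ∧ 0 < c₂ ∧ ∀ x : A, ∃ s : A⁺¹,
    HasSum (fun j => frameTerm x (u j)) s ∧
    (c₁ : ℂ) • innerSelf x ≤ s ∧ s ≤ (c₂ : ℂ) • innerSelf x

/-- Non-standard frames: the net of finite partial sums of `∑ⱼ ⟨x, xⱼ⟩⟨xⱼ, x⟩` converges
ultraweakly to an element of the universal enveloping von Neumann algebra of `A⁺¹`, which lies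
between `c₁⟨x, x⟩` and `c₂⟨x, x⟩`. -/
def IsNonstandardFrame {J : Type*} (u : J → A) : Prop :=
  ∃ c₁ c₂ : ℝ, 0 < c₁ ∧ 0 < c₂ ∧ ∀ x : A, ∃ T ∈ envelopingAlgebra A⁺¹,
    UltraweakTendsto (fun s : Finset J => universalRep (∑ j ∈ s, frameTerm x (u j))) atTop T ∧
    (c₁ : ℂ) • universalRep (innerSelf x) ≤ T ∧ T ≤ (c₂ : ℂ) • universalRep (innerSelf x)

/-- A frame is a family which is a standard or a non-standard frame. -/
def IsFrame {J : Type*} (u : J → A) : Prop :=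
  IsStandardFrame u ∨ IsNonstandardFrame u

end Frames

/-! ### The algebra `C₀(K)` and its multipliers `C_b(K)` -/

section FunctionAlgebra

variable {K : Type*} [TopologicalSpace K]

/-- The pointwise order on `C₀(K)`. -/
instance instPartialOrderC₀ : PartialOrder C₀(K, ℂ) :=
  PartialOrder.lift (fun f : C₀(K, ℂ) => (f : K → ℂ)) DFunLike.coe_injective

theorem C₀_le_def (f g : C₀(K, ℂ)) : f ≤ g ↔ ∀ t, f t ≤ g t := Iff.rfl

/-- The pointwise order is the order of the `C⋆`-algebra `C₀(K)`. -/
instance instStarOrderedRingC₀ : StarOrderedRing C₀(K, ℂ) :=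
  StarOrderedRing.of_nonneg_iff'
    (fun {x y} hxy z t => by simpa using hxy t)
    (fun x => by
      constructor
      · intro hx
        have hx' : ∀ t, 0 ≤ x t := fun t => by simpa using hx t
        refine ⟨⟨⟨fun t => ((Real.sqrt ‖x t‖ : ℝ) : ℂ), by fun_prop⟩, ?_⟩, ?_⟩
        · have h := x.zero_at_infty'
          have h2 : Continuous (fun z : ℂ => ((Real.sqrt ‖z‖ : ℝ) : ℂ)) := by fun_prop
          have h3 := h2.tendsto 0
          simp only [norm_zero, Real.sqrt_zero, Complex.ofReal_zero] at h3
          exact h3.comp h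
        · ext t
          change x t = star ((Real.sqrt ‖x t‖ : ℝ) : ℂ) * ((Real.sqrt ‖x t‖ : ℝ) : ℂ)
          rw [Complex.star_def, Complex.conj_ofReal, ← Complex.ofReal_mul,
            Real.mul_self_sqrt (norm_nonneg _)]
          exact Complex.eq_coe_norm_of_nonneg (hx' t)
      · rintro ⟨s, rfl⟩ t
        exact star_mul_self_nonneg (s t))

/-- The product of a bounded continuous function and a function vanishing at infinity. -/
def bmul (b : K →ᵇ ℂ) (f : C₀(K, ℂ)) : C₀(K, ℂ) where
  toFun t := b t * f t
  continuous_toFun := b.continuous.mul f.1.continuous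
  zero_at_infty' := by
    refine squeeze_zero_norm (a := fun t => ‖b‖ * ‖f t‖) (fun t => ?_) ?_
    · rw [norm_mul]
      exact mul_le_mul_of_nonneg_right (b.norm_coe_le_norm t) (norm_nonneg _)
    · have h := (f.zero_at_infty'.norm).const_mul ‖b‖
      simpa using h

theorem bmul_apply (b : K →ᵇ ℂ) (f : C₀(K, ℂ)) (t : K) : bmul b f t = b t * f t := rfl

/-- The operator on `C₀(K)` of multiplication by a bounded continuous function. -/
def mulOperator (b : K →ᵇ ℂ) : C₀(K, ℂ) →L[ℂ] C₀(K, ℂ) :=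
  LinearMap.mkContinuous
    { toFun := bmul b
      map_add' := fun f g => by ext t; simp [bmul_apply, mul_add]
      map_smul' := fun c f => by ext t; simp [bmul_apply, mul_left_comm] }
    ‖b‖ (fun f => by
      change ‖(bmul b f).toBCF‖ ≤ ‖b‖ * ‖f.toBCF‖
      refine (BoundedContinuousFunction.norm_le (by positivity)).2 fun t => ?_
      change ‖b t * f t‖ ≤ _
      rw [norm_mul]
      exact mul_le_mul (b.norm_coe_le_norm t) (f.toBCF.norm_coe_le_norm t) (norm_nonneg _)
        (norm_nonneg _))

theorem mulOperator_apply (b : K →ᵇ ℂ) (f : C₀(K, ℂ)) (t : K) :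
    mulOperator b f t = b t * f t := rfl

/-- The inner product `⟨x, y⟩ = x̄ y ∈ C₀(K)` of `x ∈ C₀(K)` and `y ∈ C_b(K)`. -/
def innerMultiplier (x : C₀(K, ℂ)) (y : K →ᵇ ℂ) : C₀(K, ℂ) := bmul y (star x)

theorem innerMultiplier_apply (x : C₀(K, ℂ)) (y : K →ᵇ ℂ) (t : K) :
    innerMultiplier x y t = y t * star (x t) := rfl

/-- A sequence `X` in `C_b(K)` is (outer) admissible for `C₀(K)`: for every `x ∈ C₀(K)` the series
`∑ᵢ ⟨x, xᵢ⟩⟨xᵢ, x⟩` converges in norm to an element that is at most `⟨x, x⟩`, and `‖xᵢ‖ ≤ 1`.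
Finite systems are covered by adding zeros; note that `⟨xᵢ, x⟩ = ⟨x, xᵢ⟩⋆`. -/
def IsAdmissible (X : ℕ → K →ᵇ ℂ) : Prop :=
  (∀ x : C₀(K, ℂ), ∃ s : C₀(K, ℂ),
    Tendsto (fun n => ∑ i ∈ Finset.range n, innerMultiplier x (X i) * star (innerMultiplier x (X i)))
      atTop (𝓝 s) ∧ s ≤ star x * x) ∧
  ∀ i, ‖X i‖ ≤ 1

/-- The seminorm `ν_{X,Φ}(x) = (sup_k ∑_{i ≥ k} |φ_k(⟨x, x_i⟩)|²)^{1/2}`, with values in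
`[0, ∞]`. -/
def nu (X : ℕ → K →ᵇ ℂ) (Φ : ℕ → C₀(K, ℂ) →L[ℂ] ℂ) (x : C₀(K, ℂ)) : ℝ≥0∞ :=
  (⨆ k : ℕ, ∑' i : ℕ, ‖Φ k (innerMultiplier x (X (k + i)))‖ₑ ^ 2) ^ (1 / 2 : ℝ)

/-- `Y ⊆ C₀(K)` is `(C_b(K), C₀(K))`-totally bounded: for every admissible `X`, every sequence `Φ`
of states and every `ε > 0` there is a finite `ε`-net in `Y` for `d_{X,Φ}(x, y) = ν_{X,Φ}(x - y)`. -/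
def IsOuterTotallyBounded (Y : Set C₀(K, ℂ)) : Prop :=
  ∀ (X : ℕ → K →ᵇ ℂ) (Φ : ℕ → C₀(K, ℂ) →L[ℂ] ℂ), IsAdmissible X → (∀ k, IsState (Φ k)) →
    ∀ ε : ℝ, 0 < ε → ∃ N : Set C₀(K, ℂ), N.Finite ∧ N ⊆ Y ∧
      ∀ y ∈ Y, ∃ z ∈ N, nu X Φ (z - y) < ENNReal.ofReal ε

end FunctionAlgebra

/-- The indicator function of the first summand of a disjoint union, in `C_b(P₁ ⊔ P₂)`. -/
def indicatorInl (P₁ P₂ : Type*) [TopologicalSpace P₁] [TopologicalSpace P₂] : (P₁ ⊕ P₂) →ᵇ ℂ :=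
  BoundedContinuousFunction.ofNormedAddCommGroup
    (Sum.elim (fun _ => 1) (fun _ => 0)) (continuous_const.sumElim continuous_const) 1
    (by rintro (t | t) <;> simp)

end CStarFrames

end

noncomputable section

namespace CStarFrames

/-! ### Supports, bump functions and the classes of spaces -/

section Topological

variable {K : Type*} [TopologicalSpace K]

/-! Functions in `C₀(K)` have σ-compact support, and every bounded functional on `C₀(K)` is carried
by a σ-compact set. In `P₁` such sets are precompact, yet never all of `P₁`.

Total boundedness: countably many states see only a precompact part of `P₁`. Some `e` in `C₀(K)` is
`1` there, so for these states `F x` may be replaced by `e * F x` (`exists_isSigmaCompact_carrier`).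
Admissibility applied to `e` makes the tails of the seminorm uniformly small, and finitely many
bounded coordinates remain (`exists_finite_net`).

Non-compactness: a combination of operators `theta` is multiplication by some `g` in `C₀(K)`. Were
the indicator uniformly close to such a `g`, then `P₁` would be compact.

No frames: evaluating the frame inequality at `t` shows that the members nonzero at `t` form a
countable nonempty set. For ultraweak convergence, evaluation is a vector functional of the
universal representation. Choose points of `P₁` inductively, each outside every support containing
an earlier point. The sequence is precompact, and a member nonzero at a cluster point is nonzero at
two of its terms, a contradiction (`ClassIV.not_forall_countable_nonempty`). -/

theorem norm_apply_le (f : C₀(K, ℂ)) (t : K) : ‖f t‖ ≤ ‖f‖ :=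
  f.toBCF.norm_coe_le_norm t

theorem norm_le_of_forall {f : C₀(K, ℂ)} {M : ℝ} (hM : 0 ≤ M) (h : ∀ t, ‖f t‖ ≤ M) : ‖f‖ ≤ M :=
  (BoundedContinuousFunction.norm_le (f := f.toBCF) hM).2 h

theorem isCompact_le_norm (f : C₀(K, ℂ)) {r : ℝ} (hr : 0 < r) : IsCompact {t | r ≤ ‖f t‖} := by
  have h := (f.zero_at_infty'.norm).eventually_lt_const (u := r) (by simpa using hr)
  obtain ⟨C, hC, hsub⟩ := mem_cocompact.1 h
  refine hC.of_isClosed_subset (isClosed_le continuous_const f.1.continuous.norm) fun t ht => ?_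
  by_contra htC
  exact (not_lt.2 ht) (show ‖f t‖ < r from hsub htC)

theorem isSigmaCompact_support (f : C₀(K, ℂ)) : IsSigmaCompact (Function.support f) := by
  have : Function.support f = ⋃ n : ℕ, {t | 1 / ((n : ℝ) + 1) ≤ ‖f t‖} := by
    ext t
    simp only [Function.mem_support, mem_iUnion, mem_ofPred_eq]
    constructor
    · intro h
      obtain ⟨n, hn⟩ := exists_nat_one_div_lt (norm_pos_iff.2 h)
      exact ⟨n, hn.le⟩
    · rintro ⟨n, hn⟩ h
      rw [h, norm_zero] at hn
      exact absurd hn (not_le.2 (by positivity))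
  rw [this]
  exact isSigmaCompact_iUnion_of_isCompact _ fun n => isCompact_le_norm f (by positivity)

theorem exists_bump [T2Space K] [LocallyCompactSpace K] {C : Set K} (hC : IsCompact C) :
    ∃ e : C₀(K, ℂ), (∀ t ∈ C, e t = 1) ∧ ‖e‖ ≤ 1 := by
  obtain ⟨f, h1, -, hc, h01⟩ := exists_continuous_one_zero_of_isCompact hC isClosed_empty
    (disjoint_empty C)
  refine ⟨⟨⟨fun t => (f t : ℂ), by fun_prop⟩, ?_⟩, fun t ht => ?_,
    norm_le_of_forall zero_le_one fun s => ?_⟩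
  · have h : Tendsto f (cocompact K) (𝓝 0) := hc.is_zero_at_infty
    exact (Complex.continuous_ofReal.tendsto' 0 0 (by simp)).comp h
  · change ((f t : ℝ) : ℂ) = 1
    rw [h1 ht]; simp
  · change ‖((f s : ℝ) : ℂ)‖ ≤ 1
    rw [Complex.norm_real, Real.norm_of_nonneg (h01 s).1]
    exact (h01 s).2

theorem _root_.IsSigmaCompact.preimage_isClosedEmbedding {X Y : Type*} [TopologicalSpace X]
    [TopologicalSpace Y] {i : X → Y} (hi : IsClosedEmbedding i) {s : Set Y}
    (hs : IsSigmaCompact s) : IsSigmaCompact (i ⁻¹' s) := by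
  obtain ⟨C, hC, rfl⟩ := hs
  rw [preimage_iUnion]
  exact isSigmaCompact_iUnion_of_isCompact _ fun n => hi.isCompact_preimage (hC n)

theorem locallyCompactSpace_sum {X Y : Type*} [TopologicalSpace X] [TopologicalSpace Y]
    [LocallyCompactSpace X] [LocallyCompactSpace Y] : LocallyCompactSpace (X ⊕ Y) := by
  refine ⟨?_⟩
  rintro (x | y) n hn
  · obtain ⟨s, hs, hsn, hsc⟩ := local_compact_nhds (continuous_inl.continuousAt.preimage_mem_nhds hn)
    exact ⟨Sum.inl '' s, IsOpenEmbedding.inl.isOpenMap.image_mem_nhds hs, image_subset_iff.2 hsn,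
      hsc.image continuous_inl⟩
  · obtain ⟨s, hs, hsn, hsc⟩ := local_compact_nhds (continuous_inr.continuousAt.preimage_mem_nhds hn)
    exact ⟨Sum.inr '' s, IsOpenEmbedding.inr.isOpenMap.image_mem_nhds hs, image_subset_iff.2 hsn,
      hsc.image continuous_inr⟩

theorem ClassIV.ne_univ_of_isSigmaCompact (h : ClassIV K) {s : Set K} (hs : IsSigmaCompact s) :
    s ≠ univ := by
  rintro rfl
  simpa using h.2.2.1 _ hs

theorem exists_isSigmaCompact_not_isCompact_closure
    (h : ClassI K ∨ ClassII K ∨ ClassIII K) (hK : ¬ CompactSpace K) :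
    ∃ s : Set K, IsSigmaCompact s ∧ ¬ IsCompact (closure s) := by
  rcases h with h | h | h
  · refine ⟨univ, h.2.2.isSigmaCompact_univ, fun hc => hK ⟨?_⟩⟩
    simpa using hc
  · obtain ⟨s, hs, hd⟩ := h.2.2.2
    refine ⟨s, hs, fun hc => hK ⟨?_⟩⟩
    rwa [hd.closure_eq] at hc
  · exact h.2.2.2

/-- Both summands are clopen: the interior points come from `P₁`, and the σ-compact set that is not
precompact comes from `P₂`. -/
theorem classIII_sum {P₁ P₂ : Type*} [TopologicalSpace P₁] [TopologicalSpace P₂]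
    (h₁ : ClassIV P₁) (h₂ : ClassI P₂ ∨ ClassII P₂ ∨ ClassIII P₂) (hP : ¬ CompactSpace P₂) :
    ClassIII (P₁ ⊕ P₂) := by
  have : LocallyCompactSpace P₁ := h₁.1
  have : T2Space P₁ := h₁.2.1
  have : LocallyCompactSpace P₂ := by rcases h₂ with h | h | h <;> exact h.1
  have : T2Space P₂ := by rcases h₂ with h | h | h <;> exact h.2.1
  refine ⟨locallyCompactSpace_sum, inferInstance, fun s hs => ?_, ?_⟩
  · obtain ⟨t, ht⟩ := h₁.2.2.1 _ (hs.preimage_isClosedEmbedding IsClosedEmbedding.inl)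
    refine ⟨Sum.inl t, mem_interior.2 ⟨Sum.inl '' interior (Sum.inl ⁻¹' s)ᶜ, ?_,
      IsOpenEmbedding.inl.isOpenMap _ isOpen_interior, mem_image_of_mem _ ht⟩⟩
    exact image_subset_iff.2 interior_subset
  · obtain ⟨s, hs, hc⟩ := exists_isSigmaCompact_not_isCompact_closure h₂ hP
    refine ⟨Sum.inr '' s, hs.image continuous_inr, fun h => hc ?_⟩
    rw [IsClosedEmbedding.inr.closure_image_eq] at h
    exact IsClosedEmbedding.inr.isEmbedding.isCompact_iff.2 h

end Topological

/-! ### Multiplication operators: adjoints and compactness -/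

section Compactness

variable {K : Type*} [TopologicalSpace K]

theorem isModuleOperator_mulOperator (b : K →ᵇ ℂ) : IsModuleOperator (mulOperator b) := fun x a => by
  ext t; simp [mulOperator_apply, mul_assoc]

theorem isAdjointable_mulOperator {b : K →ᵇ ℂ} (hb : ∀ t, star (b t) = b t) :
    IsAdjointable (mulOperator b) := by
  refine ⟨isModuleOperator_mulOperator b, mulOperator b, isModuleOperator_mulOperator b,
    fun x y => ?_⟩
  ext t
  simp only [ZeroAtInftyContinuousMap.mul_apply, ZeroAtInftyContinuousMap.star_apply,
    mulOperator_apply, star_mul', hb]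
  ring

/-- By associativity `theta x y` is multiplication by `x * star y`, and multiplications are closed
under linear combinations. -/
theorem exists_eq_mul_of_mem_span_theta {T : C₀(K, ℂ) →L[ℂ] C₀(K, ℂ)}
    (hT : T ∈ Submodule.span ℂ {T : C₀(K, ℂ) →L[ℂ] C₀(K, ℂ) | ∃ x y, T = theta x y}) :
    ∃ g : C₀(K, ℂ), ∀ z, T z = g * z := by
  induction hT using Submodule.span_induction with
  | mem T h =>
    obtain ⟨x, y, rfl⟩ := h
    exact ⟨x * star y, fun z => by rw [theta_apply, mul_assoc]⟩
  | zero => exact ⟨0, fun z => by simp⟩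
  | add S T _ _ hS hT =>
    obtain ⟨g, hg⟩ := hS
    obtain ⟨h, hh⟩ := hT
    exact ⟨g + h, fun z => by simp [hg, hh, add_mul]⟩
  | smul c T _ hT =>
    obtain ⟨g, hg⟩ := hT
    exact ⟨c • g, fun z => by simp [hg, smul_mul_assoc]⟩

/-- Multiplication by `b` can be `C₀(K)`-compact only if `b` is small outside a compact set. -/
theorem isCompact_one_le_norm_of_isACompact [T2Space K] [LocallyCompactSpace K] {b : K →ᵇ ℂ}
    (hb : IsACompact (mulOperator b)) : IsCompact {t | 1 ≤ ‖b t‖} := by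
  obtain ⟨T, hT, hd⟩ := Metric.mem_closure_iff.1 hb (1 / 2) (by norm_num)
  obtain ⟨g, hg⟩ := exists_eq_mul_of_mem_span_theta hT
  refine (isCompact_le_norm g (r := 1 / 2) (by norm_num)).of_isClosed_subset
    (isClosed_le continuous_const b.continuous.norm) fun t (ht : 1 ≤ ‖b t‖) => ?_
  obtain ⟨e, het, he⟩ := exists_bump (isCompact_singleton (x := t))
  replace het : e t = 1 := het t rfl
  -- Testing on a bump `e` with `e t = 1` bounds the pointwise distance of the symbols by the
  -- operator distance.
  have h1 : ‖b t - g t‖ ≤ ‖mulOperator b - T‖ := by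
    have h2 := (norm_apply_le ((mulOperator b - T) e) t).trans
      ((mulOperator b - T).le_of_opNorm_le_of_le le_rfl he)
    simpa [mulOperator_apply, hg, het] using h2
  rw [dist_eq_norm] at hd
  have h3 := norm_sub_norm_le (b t) (g t)
  change 1 / 2 ≤ ‖g t‖
  linarith

theorem not_isACompact_mulOperator_indicatorInl {P₁ P₂ : Type*} [TopologicalSpace P₁]
    [TopologicalSpace P₂] [T2Space P₁] [T2Space P₂] [LocallyCompactSpace P₁]
    [LocallyCompactSpace P₂] (h₁ : ClassIV P₁) :
    ¬ IsACompact (mulOperator (indicatorInl P₁ P₂)) := fun h => by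
  have := locallyCompactSpace_sum (X := P₁) (Y := P₂)
  have h2 := (isCompact_one_le_norm_of_isACompact (K := P₁ ⊕ P₂) h).isSigmaCompact
  refine h₁.ne_univ_of_isSigmaCompact (h2.preimage_isClosedEmbedding IsClosedEmbedding.inl) ?_
  ext t
  simp [indicatorInl]

end Compactness

/-! ### Functionals on `C₀(K)` and total boundedness -/

section TotallyBounded

variable {K : Type*} [TopologicalSpace K]

/-- Rotate both values to be nonnegative reals; the rotated sum still has norm at most one, because
the supports are disjoint. -/
theorem norm_add_norm_le_opNorm_of_mul_eq_zero (φ : C₀(K, ℂ) →L[ℂ] ℂ) {f g : C₀(K, ℂ)}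
    (hf : ‖f‖ ≤ 1) (hg : ‖g‖ ≤ 1) (hfg : ∀ t, f t = 0 ∨ g t = 0) : ‖φ f‖ + ‖φ g‖ ≤ ‖φ‖ := by
  obtain ⟨a, ha, hfa⟩ := RCLike.exists_norm_eq_mul_self (φ f)
  obtain ⟨b, hb, hgb⟩ := RCLike.exists_norm_eq_mul_self (φ g)
  have hn : ‖a • f + b • g‖ ≤ 1 := norm_le_of_forall zero_le_one fun t => by
    have h1 := norm_apply_le f t
    have h2 := norm_apply_le g t
    rcases hfg t with h | h
    · simp only [ZeroAtInftyContinuousMap.add_apply, ZeroAtInftyContinuousMap.smul_apply, h,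
        smul_zero, zero_add, norm_smul, hb]
      linarith
    · simp only [ZeroAtInftyContinuousMap.add_apply, ZeroAtInftyContinuousMap.smul_apply, h,
        smul_zero, add_zero, norm_smul, ha]
      linarith
  have h := φ.le_of_opNorm_le_of_le le_rfl hn
  have h3 : φ (a • f + b • g) = ((‖φ f‖ + ‖φ g‖ : ℝ) : ℂ) := by
    rw [map_add, map_smul, map_smul, smul_eq_mul, smul_eq_mul, ← hfa, ← hgb]
    push_cast; rfl
  rw [h3, Complex.norm_real, Real.norm_of_nonneg (by positivity), mul_one] at h
  exact h

/-- Every bounded functional on `C₀(K)` is carried by a `σ`-compact set. -/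
theorem exists_isSigmaCompact_carrier (φ : C₀(K, ℂ) →L[ℂ] ℂ) :
    ∃ S : Set K, IsSigmaCompact S ∧ ∀ g : C₀(K, ℂ), (∀ t ∈ S, g t = 0) → φ g = 0 := by
  -- The carrier is the union of the supports of an almost norming sequence. A function vanishing
  -- there with nonzero value would push `φ` beyond its norm.
  have h : ∀ n : ℕ, ∃ f : C₀(K, ℂ), ‖f‖ < 1 ∧ ‖φ‖ - 1 / ((n : ℝ) + 1) < ‖φ f‖ := fun n =>
    φ.exists_lt_apply_of_lt_opNorm (sub_lt_self _ (by positivity))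
  choose f hf hφ using h
  refine ⟨⋃ n, Function.support (f n), isSigmaCompact_iUnion _ fun n => isSigmaCompact_support _,
    fun g hg => ?_⟩
  have hc : (0 : ℝ) < ‖g‖ + 1 := by positivity
  -- Dividing by `‖g‖ + 1` keeps the scaling legitimate when `g = 0`.
  set u : C₀(K, ℂ) := (((‖g‖ + 1)⁻¹ : ℝ) : ℂ) • g with hu
  have hun : ‖u‖ ≤ 1 := by
    rw [hu, norm_smul, Complex.norm_real, Real.norm_of_nonneg (by positivity), inv_mul_le_iff₀ hc]
    linarith
  have hu0 : φ u = 0 := by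
    by_contra hne
    obtain ⟨n, hn⟩ := exists_nat_one_div_lt (norm_pos_iff.2 hne)
    have h1 := norm_add_norm_le_opNorm_of_mul_eq_zero φ (hf n).le hun fun t => by
      by_cases ht : f n t = 0
      · exact Or.inl ht
      · exact Or.inr (by simp [hu, hg t (mem_iUnion.2 ⟨n, ht⟩)])
    have h2 := hφ n
    linarith
  rw [hu, map_smul, smul_eq_zero] at hu0
  exact hu0.resolve_left (by exact_mod_cast (inv_pos.2 hc).ne')

theorem sum_apply {ι : Type*} (s : Finset ι) (g : ι → C₀(K, ℂ)) (t : K) :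
    (∑ i ∈ s, g i) t = ∑ i ∈ s, g i t := by
  induction s using Finset.cons_induction with
  | empty => simp
  | cons a s ha ih => simp [ih]

/-- Duality: for `h = ∑ star (φ (g i)) • g i` the value `φ h` is the sum `Q` in question, while
Cauchy–Schwarz at each point gives `‖h‖ ≤ √Q * M`. Hence `Q ≤ ‖φ‖ * √Q * M`. -/
theorem sum_norm_sq_apply_le (φ : C₀(K, ℂ) →L[ℂ] ℂ) {ι : Type*} (s : Finset ι) (g : ι → C₀(K, ℂ))
    {M : ℝ} (hM : 0 ≤ M) (hg : ∀ t, ∑ i ∈ s, ‖g i t‖ ^ 2 ≤ M ^ 2) :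
    ∑ i ∈ s, ‖φ (g i)‖ ^ 2 ≤ (‖φ‖ * M) ^ 2 := by
  set Q : ℝ := ∑ i ∈ s, ‖φ (g i)‖ ^ 2 with hQ
  have hQ0 : 0 ≤ Q := Finset.sum_nonneg fun i _ => by positivity
  set h : C₀(K, ℂ) := ∑ i ∈ s, star (φ (g i)) • g i with hh
  have hφh : φ h = (Q : ℂ) := by
    rw [hh, map_sum, hQ, Complex.ofReal_sum]
    refine Finset.sum_congr rfl fun i _ => ?_
    rw [map_smul, smul_eq_mul, Complex.star_def, Complex.conj_mul', Complex.ofReal_pow]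
  have happ : ∀ t, h t = ∑ i ∈ s, star (φ (g i)) * g i t := fun t => by
    rw [hh, sum_apply]; rfl
  have hn : ‖h‖ ≤ √Q * M := norm_le_of_forall (by positivity) fun t => by
    rw [happ]
    calc ‖∑ i ∈ s, star (φ (g i)) * g i t‖ ≤ ∑ i ∈ s, ‖φ (g i)‖ * ‖g i t‖ :=
          (norm_sum_le _ _).trans (Finset.sum_le_sum fun i _ => by rw [norm_mul, norm_star])
      _ ≤ √(∑ i ∈ s, ‖φ (g i)‖ ^ 2) * √(∑ i ∈ s, ‖g i t‖ ^ 2) :=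
          Real.sum_mul_le_sqrt_mul_sqrt _ _ _
      _ ≤ √Q * M := by
          gcongr
          exact Real.sqrt_le_iff.2 ⟨hM, hg t⟩
  have h1 := φ.le_of_opNorm_le_of_le le_rfl hn
  rw [hφh, Complex.norm_real, Real.norm_of_nonneg hQ0] at h1
  have h2 : √Q * √Q ≤ √Q * (‖φ‖ * M) := by rw [Real.mul_self_sqrt hQ0]; linarith
  have h3 : √Q ≤ ‖φ‖ * M := by
    rcases (Real.sqrt_nonneg Q).eq_or_lt with h0 | h0
    · rw [← h0]; positivity
    · exact le_of_mul_le_mul_left h2 h0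
  exact (Real.sqrt_le_left (by positivity)).1 h3

/-- Norm convergence of the series for `e` makes the Cauchy bound uniform in `t`; an arbitrary
finite tail set sits inside an interval of indices. -/
theorem IsAdmissible.exists_tail_le {X : ℕ → K →ᵇ ℂ} (hX : IsAdmissible X) (e : C₀(K, ℂ))
    {δ : ℝ} (hδ : 0 < δ) :
    ∃ m, ∀ s : Finset ℕ, (∀ i ∈ s, m ≤ i) → ∀ t, ∑ i ∈ s, ‖X i t * star (e t)‖ ^ 2 ≤ δ := by
  obtain ⟨S, hS, -⟩ := hX.1 e
  obtain ⟨m, hm⟩ := Metric.cauchySeq_iff'.1 hS.cauchySeq δ hδ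
  refine ⟨m, fun s hs t => ?_⟩
  obtain ⟨n, hn⟩ := s.exists_nat_subset_range
  have hsub : s ⊆ Finset.Ico m (max m n) := fun i hi =>
    Finset.mem_Ico.2 ⟨hs i hi, lt_max_of_lt_right (Finset.mem_range.1 (hn hi))⟩
  refine (Finset.sum_le_sum_of_subset_of_nonneg hsub fun _ _ _ => by positivity).trans ?_
  have h1 := (hm (max m n) (le_max_left _ _)).le
  rw [dist_eq_norm, ← Finset.sum_Ico_eq_sub _ (le_max_left m n)] at h1
  have h2 := (norm_apply_le _ t).trans h1
  have h3 : (∑ i ∈ Finset.Ico m (max m n), innerMultiplier e (X i) * star (innerMultiplier e (X i))) t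
      = ((∑ i ∈ Finset.Ico m (max m n), ‖X i t * star (e t)‖ ^ 2 : ℝ) : ℂ) := by
    rw [sum_apply, Complex.ofReal_sum]
    refine Finset.sum_congr rfl fun i _ => ?_
    rw [ZeroAtInftyContinuousMap.mul_apply, ZeroAtInftyContinuousMap.star_apply,
      innerMultiplier_apply, Complex.ofReal_pow]
    exact Complex.mul_conj' _
  rw [h3, Complex.norm_real] at h2
  exact (le_abs_self _).trans h2

theorem innerMultiplier_sub (x y : C₀(K, ℂ)) (b : K →ᵇ ℂ) :
    innerMultiplier (x - y) b = innerMultiplier x b - innerMultiplier y b := by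
  ext t; simp [innerMultiplier_apply, mul_sub]

theorem norm_innerMultiplier_le (x : C₀(K, ℂ)) (b : K →ᵇ ℂ) :
    ‖innerMultiplier x b‖ ≤ ‖b‖ * ‖x‖ :=
  norm_le_of_forall (by positivity) fun t => by
    rw [innerMultiplier_apply, norm_mul, norm_star]
    exact mul_le_mul (b.norm_coe_le_norm t) (norm_apply_le x t) (norm_nonneg _) (norm_nonneg _)

theorem nu_lt_of_forall_sum_le {X : ℕ → K →ᵇ ℂ} {Φ : ℕ → C₀(K, ℂ) →L[ℂ] ℂ} {x : C₀(K, ℂ)} {ε : ℝ}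
    (hε : 0 < ε)
    (h : ∀ k n, ∑ i ∈ Finset.range n, ‖Φ k (innerMultiplier x (X (k + i)))‖ ^ 2 ≤ ε ^ 2 / 2) :
    nu X Φ x < ENNReal.ofReal ε := by
  have h1 : (⨆ k : ℕ, ∑' i : ℕ, ‖Φ k (innerMultiplier x (X (k + i)))‖ₑ ^ 2)
      ≤ ENNReal.ofReal (ε ^ 2 / 2) := by
    -- The bound `ε ^ 2 / 2` leaves room for strict inequality after the supremum.
    refine iSup_le fun k => ENNReal.tsum_le_of_sum_range_le fun n => ?_
    refine le_trans (le_of_eq ?_) (ENNReal.ofReal_le_ofReal (h k n))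
    rw [ENNReal.ofReal_sum_of_nonneg fun _ _ => by positivity]
    refine Finset.sum_congr rfl fun i _ => ?_
    rw [ENNReal.ofReal_pow (norm_nonneg _), ofReal_norm]
  calc nu X Φ x ≤ ENNReal.ofReal (ε ^ 2 / 2) ^ (1 / 2 : ℝ) :=
        ENNReal.rpow_le_rpow h1 (by norm_num)
    _ < ENNReal.ofReal (ε ^ 2) ^ (1 / 2 : ℝ) := by
        refine ENNReal.rpow_lt_rpow ?_ (by norm_num)
        exact (ENNReal.ofReal_lt_ofReal_iff (by positivity)).2 (by nlinarith [sq_pos_of_pos hε])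
    _ = ENNReal.ofReal ε := by
        rw [ENNReal.ofReal_rpow_of_nonneg (by positivity) (by norm_num), ← Real.sqrt_eq_rpow,
          Real.sqrt_sq hε.le]

/-- If some `e ∈ C₀(K)` acts as a unit on `Y` under every one of the functionals considered, then
the bounded set `Y` is totally bounded for the seminorms `nu`. -/
theorem exists_finite_net {X : ℕ → K →ᵇ ℂ} {Φ : ℕ → C₀(K, ℂ) →L[ℂ] ℂ} (hX : IsAdmissible X)
    (hΦ : ∀ k, ‖Φ k‖ ≤ 1) {Y : Set C₀(K, ℂ)} (hY : ∀ y ∈ Y, ‖y‖ ≤ 1) (e : C₀(K, ℂ))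
    (he : ∀ y ∈ Y, ∀ k i, Φ k (innerMultiplier y (X i)) = Φ k (innerMultiplier (e * y) (X i)))
    {ε : ℝ} (hε : 0 < ε) :
    ∃ N : Set C₀(K, ℂ), N.Finite ∧ N ⊆ Y ∧ ∀ y ∈ Y, ∃ z ∈ N, nu X Φ (z - y) < ENNReal.ofReal ε := by
  -- Since `‖z - y‖ ≤ 2` costs a factor `4` after squaring, `ε ^ 2 / 16` yields a tail of at most `ε
  -- ^ 2 / 4`.
  obtain ⟨m, hm⟩ := hX.exists_tail_le e (δ := ε ^ 2 / 16) (by positivity)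
  -- At most `m` head terms, each at most `η ^ 2`, add up to at most `ε ^ 2 / 4`; `m + 1` avoids
  -- dividing by zero.
  set η : ℝ := ε / (2 * (m + 1)) with hη
  have hη0 : 0 < η := by positivity
  -- Sums start at `k`, so indices below `m` occur only for `k < m`: finitely many coordinates
  -- control the heads for all `k`.
  let Ψ : C₀(K, ℂ) → (Fin m × Fin m → ℂ) := fun x p => Φ p.1 (innerMultiplier x (X p.2))
  have hΨ : TotallyBounded (Ψ '' Y) := by
    refine (isCompact_closedBall (0 : Fin m × Fin m → ℂ) 1).totallyBounded.subset ?_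
    rintro _ ⟨y, hy, rfl⟩
    rw [mem_closedBall_zero_iff, pi_norm_le_iff_of_nonneg zero_le_one]
    intro p
    have h1 := norm_innerMultiplier_le y (X p.2)
    have h2 : ‖X p.2‖ * ‖y‖ ≤ 1 := mul_le_one₀ (hX.2 _) (norm_nonneg _) (hY y hy)
    have h3 := (Φ p.1).le_of_opNorm_le_of_le (hΦ _) (h1.trans h2)
    simpa using h3
  obtain ⟨t, htY, htf, hcov⟩ := Metric.finite_approx_of_totallyBounded hΨ η hη0
  obtain ⟨N, hNY, hNf, rfl⟩ := (Set.exists_subset_image_finite_and (p := fun u => u = t)).1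
    ⟨t, htY, htf, rfl⟩
  refine ⟨N, hNf, hNY, fun y hy => ?_⟩
  obtain ⟨_, ⟨z, hz, rfl⟩, hzy⟩ := mem_iUnion₂.1 (hcov (mem_image_of_mem Ψ hy))
  refine ⟨z, hz, nu_lt_of_forall_sum_le hε fun k n => ?_⟩
  set a : ℕ → ℝ := fun j => ‖Φ k (innerMultiplier (z - y) (X j))‖ ^ 2 with ha
  have ha0 : ∀ j, 0 ≤ a j := fun j => by positivity
  have hsum : ∑ i ∈ Finset.range n, ‖Φ k (innerMultiplier (z - y) (X (k + i)))‖ ^ 2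
      = ∑ j ∈ Finset.Ico k (k + n), a j := by
    rw [Finset.sum_Ico_eq_sum_range]; simp [ha]
  rw [hsum, ← Finset.sum_filter_add_sum_filter_not _ (fun j => j < m)]
  have hlow : ∑ j ∈ Finset.Ico k (k + n) with j < m, a j ≤ ε ^ 2 / 4 := by
    have h1 : ∀ j ∈ (Finset.Ico k (k + n)).filter (· < m), a j ≤ η ^ 2 := fun j hj => by
      obtain ⟨hj1, hjm⟩ := Finset.mem_filter.1 hj
      have hkm : k < m := (Finset.mem_Ico.1 hj1).1.trans_lt hjm
      have h2 : dist (Ψ y (⟨k, hkm⟩, ⟨j, hjm⟩)) (Ψ z (⟨k, hkm⟩, ⟨j, hjm⟩)) < η :=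
        (dist_le_pi_dist (Ψ y) (Ψ z) _).trans_lt hzy
      rw [dist_comm, dist_eq_norm] at h2
      have h3 : ‖Φ k (innerMultiplier (z - y) (X j))‖ ≤ η := by
        rw [innerMultiplier_sub, map_sub]; exact h2.le
      exact pow_le_pow_left₀ (norm_nonneg _) h3 2
    have h4 : ((Finset.Ico k (k + n)).filter (· < m)).card ≤ m := by
      calc _ ≤ (Finset.range m).card := Finset.card_le_card fun j hj => by
              simpa using (Finset.mem_filter.1 hj).2
        _ = m := Finset.card_range m
    calc _ ≤ _ • η ^ 2 := Finset.sum_le_card_nsmul _ _ _ h1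
      _ ≤ m * η ^ 2 := by rw [nsmul_eq_mul]; gcongr
      _ ≤ (m + 1) ^ 2 * η ^ 2 := by gcongr; nlinarith
      _ = ε ^ 2 / 4 := by rw [hη]; field_simp; norm_num
  have hhigh : ∑ j ∈ Finset.Ico k (k + n) with ¬ j < m, a j ≤ ε ^ 2 / 4 := by
    have h1 : ∀ j, Φ k (innerMultiplier (z - y) (X j))
        = Φ k (innerMultiplier (e * (z - y)) (X j)) := fun j => by
      rw [mul_sub, innerMultiplier_sub, innerMultiplier_sub, map_sub, map_sub, he z (hNY hz),
        he y hy]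
    have h2 : ‖z - y‖ ≤ 2 := (norm_sub_le _ _).trans (by linarith [hY z (hNY hz), hY y hy])
    have h3 := sum_norm_sq_apply_le (Φ k) ((Finset.Ico k (k + n)).filter (¬ · < m))
      (fun j => innerMultiplier (e * (z - y)) (X j)) (M := ε / 2) (by positivity) fun t => by
        have h4 : ∀ j, ‖innerMultiplier (e * (z - y)) (X j) t‖ ^ 2
            ≤ 4 * ‖X j t * star (e t)‖ ^ 2 := fun j => by
          have h5 : ‖(z - y) t‖ ≤ 2 := (norm_apply_le _ t).trans h2
          rw [innerMultiplier_apply, ZeroAtInftyContinuousMap.mul_apply, star_mul', ← mul_assoc,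
            norm_mul _ (star ((z - y) t)), norm_star, mul_pow, mul_comm]
          have : ‖(z - y) t‖ ^ 2 ≤ 4 := by nlinarith [norm_nonneg ((z - y) t)]
          gcongr
        calc _ ≤ ∑ j ∈ (Finset.Ico k (k + n)).filter (¬ · < m), 4 * ‖X j t * star (e t)‖ ^ 2 :=
              Finset.sum_le_sum fun j _ => h4 j
          _ ≤ 4 * (ε ^ 2 / 16) := by
              rw [← Finset.mul_sum]
              gcongr
              exact hm _ (fun i hi => not_lt.1 (Finset.mem_filter.1 hi).2) t
          _ = (ε / 2) ^ 2 := by ring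
    calc _ = ∑ j ∈ Finset.Ico k (k + n) with ¬ j < m,
            ‖Φ k (innerMultiplier (e * (z - y)) (X j))‖ ^ 2 :=
          Finset.sum_congr rfl fun j _ => by rw [ha]; simp only [h1]
      _ ≤ (‖Φ k‖ * (ε / 2)) ^ 2 := h3
      _ ≤ (1 * (ε / 2)) ^ 2 := by gcongr; exact hΦ k
      _ = ε ^ 2 / 4 := by ring
  linarith

theorem isOuterTotallyBounded_image_indicatorInl {P₁ P₂ : Type*} [TopologicalSpace P₁]
    [TopologicalSpace P₂] [T2Space P₁] [T2Space P₂] [LocallyCompactSpace P₁]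
    [LocallyCompactSpace P₂] (h₁ : ClassIV P₁) :
    IsOuterTotallyBounded (mulOperator (indicatorInl P₁ P₂) ''
      Metric.closedBall (0 : C₀(P₁ ⊕ P₂, ℂ)) 1) := by
  intro X Φ hX hΦ ε hε
  have := locallyCompactSpace_sum (X := P₁) (Y := P₂)
  choose S hS hSφ using fun k => exists_isSigmaCompact_carrier (Φ k)
  -- The carriers of all the states together are still σ-compact, so their trace on `P₁` is
  -- precompact.
  have hC : IsCompact (closure (Sum.inl ⁻¹' ⋃ k, S k : Set P₁)) :=
    h₁.2.2.2 _ ((isSigmaCompact_iUnion S hS).preimage_isClosedEmbedding IsClosedEmbedding.inl)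
  obtain ⟨e, he, -⟩ := exists_bump (hC.image (continuous_inl (Y := P₂)))
  refine exists_finite_net hX (fun k => (hΦ k).2.le) ?_ e ?_ hε
  · rintro _ ⟨u, hu, rfl⟩
    refine norm_le_of_forall zero_le_one fun t => ?_
    rw [mulOperator_apply, norm_mul]
    refine mul_le_one₀ ?_ (norm_nonneg _)
      ((norm_apply_le u t).trans (mem_closedBall_zero_iff.1 hu))
    rcases t with t | t <;> simp [indicatorInl]
  · rintro _ ⟨u, hu, rfl⟩ k i
    rw [← sub_eq_zero, ← map_sub, ← innerMultiplier_sub]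
    refine hSφ k _ fun t ht => ?_
    rw [innerMultiplier_apply, ZeroAtInftyContinuousMap.sub_apply,
      ZeroAtInftyContinuousMap.mul_apply, mulOperator_apply]
    rcases t with t | t
    · rw [he _ (mem_image_of_mem _ (subset_closure (mem_iUnion.2 ⟨k, ht⟩)))]
      simp
    · simp [indicatorInl]

end TotallyBounded

/-! ### Vector functionals of the universal representation -/

section UniversalVector

variable {B : Type*} [CStarAlgebra B] [PartialOrder B] [StarOrderedRing B]

open Classical in
/-- The cyclic vector of the state `f` in the space of the universal representation. -/
def universalVector (f : UnitalState B) : UniversalSpace B :=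
  lp.single 2 f ((f.1.toPreGNS 1 : f.1.PreGNS) : f.1.GNS)

theorem inner_universalVector (f : UnitalState B) (b : B) :
    ⟪universalVector f, universalRep b (universalVector f)⟫_ℂ = f.1 b := by
  classical
  rw [universalVector, lp.inner_single_left, universalRep_apply, lp.single_apply_self]
  change ⟪_, f.1.gnsNonUnitalStarAlgHom b _⟫_ℂ = _
  rw [PositiveLinearMap.gnsNonUnitalStarAlgHom_apply_coe, UniformSpace.Completion.inner_coe,
    PositiveLinearMap.preGNS_inner_def]
  simp

/-- A vector functional is the ultraweak functional of sequences with a single nonzero term. -/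
theorem UltraweakTendsto.inner {H : Type*} [NormedAddCommGroup H] [InnerProductSpace ℂ H]
    {ι : Type*} {S : ι → H →L[ℂ] H} {l : Filter ι} {T : H →L[ℂ] H} (h : UltraweakTendsto S l T)
    (ξ : H) : Tendsto (fun i => ⟪ξ, S i ξ⟫_ℂ) l (𝓝 ⟪ξ, T ξ⟫_ℂ) := by
  have hs : Summable fun n : ℕ => ‖(Pi.single 0 ξ : ℕ → H) n‖ ^ 2 :=
    summable_of_ne_finset_zero (s := {0}) fun n hn => by
      rw [Pi.single_eq_of_ne (by simpa using hn)]; simp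
  have hsum : ∀ R : H →L[ℂ] H,
      ∑' n, ⟪(Pi.single 0 ξ : ℕ → H) n, R ((Pi.single 0 ξ : ℕ → H) n)⟫_ℂ = ⟪ξ, R ξ⟫_ℂ := fun R => by
    rw [tsum_eq_single 0 fun n hn => by rw [Pi.single_eq_of_ne hn]; simp]
    simp
  simpa only [hsum] using h _ _ hs hs

theorem mul_inner_le_inner_of_smul_le {H : Type*} [NormedAddCommGroup H] [InnerProductSpace ℂ H]
    {S T : H →L[ℂ] H} {c : ℂ} (h : c • S ≤ T) (ξ : H) : c * ⟪ξ, S ξ⟫_ℂ ≤ ⟪ξ, T ξ⟫_ℂ := by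
  have h2 := ((ContinuousLinearMap.le_def _ _).1 h).inner_nonneg_right ξ
  rwa [sub_apply, inner_sub_right, sub_nonneg, smul_apply, inner_smul_right] at h2

end UniversalVector

/-! ### Pointwise consequences of the frame inequality; absence of frames -/

section NoFrames

variable {K : Type*} [TopologicalSpace K]

/-- Evaluation at a point, as a non-unital character of `C₀(K)`. -/
def evalHom (t : K) : C₀(K, ℂ) →⋆ₙₐ[ℂ] ℂ where
  toFun f := f t
  map_smul' _ _ := rfl
  map_zero' := rfl
  map_add' _ _ := rfl
  map_mul' _ _ := rfl
  map_star' _ := rfl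

/-- Evaluation at a point, as a character of the unitization of `C₀(K)`. -/
def evalUnitization (t : K) : C₀(K, ℂ)⁺¹ →⋆ₐ[ℂ] ℂ := Unitization.starLift (evalHom t)

theorem evalUnitization_coe (t : K) (f : C₀(K, ℂ)) : evalUnitization t (f : C₀(K, ℂ)⁺¹) = f t :=
  DFunLike.congr_fun (Unitization.starLift.symm_apply_apply (evalHom t)) f

theorem evalUnitization_mono (t : K) : Monotone (evalUnitization t) :=
  OrderHomClass.mono (evalUnitization t)

theorem evalUnitization_frameTerm (t : K) (x y : C₀(K, ℂ)) :
    evalUnitization t (frameTerm x y) = ((‖x t‖ ^ 2 * ‖y t‖ ^ 2 : ℝ) : ℂ) := by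
  rw [frameTerm, evalUnitization_coe]
  simp only [ZeroAtInftyContinuousMap.mul_apply, ZeroAtInftyContinuousMap.star_apply]
  push_cast
  rw [← Complex.conj_mul', ← Complex.conj_mul', Complex.star_def]
  ring

theorem evalUnitization_innerSelf (t : K) (x : C₀(K, ℂ)) :
    evalUnitization t (innerSelf x) = ((‖x t‖ ^ 2 : ℝ) : ℂ) := by
  rw [innerSelf, evalUnitization_coe]
  simp only [ZeroAtInftyContinuousMap.mul_apply, ZeroAtInftyContinuousMap.star_apply]
  push_cast
  rw [← Complex.conj_mul', Complex.star_def]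

/-- Evaluation at a point, as a state of the unitization of `C₀(K)`. -/
def evalState (t : K) : UnitalState C₀(K, ℂ)⁺¹ :=
  ⟨PositiveLinearMap.mk (evalUnitization t).toAlgHom.toLinearMap (evalUnitization_mono t),
    map_one (evalUnitization t)⟩

theorem evalState_apply (t : K) (b : C₀(K, ℂ)⁺¹) : (evalState t).1 b = evalUnitization t b := rfl

/-- Both kinds of frame are reduced to the same scalar statement; only summability and the lower
bound are needed. -/
theorem IsStandardFrame.exists_hasSum_eval {J : Type*} {u : J → C₀(K, ℂ)} (hu : IsStandardFrame u)
    (t : K) : ∃ c : ℝ, 0 < c ∧ ∀ x : C₀(K, ℂ), ∃ s : ℂ,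
      HasSum (fun j => evalUnitization t (frameTerm x (u j))) s ∧
      c * evalUnitization t (innerSelf x) ≤ s := by
  obtain ⟨c₁, c₂, h₁, -, h⟩ := hu
  refine ⟨c₁, h₁, fun x => ?_⟩
  obtain ⟨s, hs, hle, -⟩ := h x
  refine ⟨evalUnitization t s, hs.map (evalUnitization t) (map_continuous _), ?_⟩
  simpa using evalUnitization_mono t hle

theorem IsNonstandardFrame.exists_hasSum_eval {J : Type*} {u : J → C₀(K, ℂ)}
    (hu : IsNonstandardFrame u) (t : K) : ∃ c : ℝ, 0 < c ∧ ∀ x : C₀(K, ℂ), ∃ s : ℂ,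
      HasSum (fun j => evalUnitization t (frameTerm x (u j))) s ∧
      c * evalUnitization t (innerSelf x) ≤ s := by
  obtain ⟨c₁, c₂, h₁, -, h⟩ := hu
  refine ⟨c₁, h₁, fun x => ?_⟩
  obtain ⟨T, -, hT, hle, -⟩ := h x
  set ξ := universalVector (evalState t)
  refine ⟨⟪ξ, T ξ⟫_ℂ, ?_, ?_⟩
  · have := hT.inner ξ
    simp only [ξ, inner_universalVector, evalState_apply] at this
    simp only [map_sum] at this
    exact this
  · simpa only [ξ, inner_universalVector, evalState_apply] using mul_inner_le_inner_of_smul_le hle ξ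

/-- With `x t = 1` the evaluated terms are `‖u j t‖ ^ 2`. A summable scalar family has countable
support, and the lower bound `c > 0` forbids a zero family. -/
theorem IsFrame.support_countable_nonempty [T2Space K] [LocallyCompactSpace K] {J : Type*}
    {u : J → C₀(K, ℂ)} (hu : IsFrame u) (t : K) :
    {j | u j t ≠ 0}.Countable ∧ {j | u j t ≠ 0}.Nonempty := by
  obtain ⟨c, hc, h⟩ := hu.elim (fun h => h.exists_hasSum_eval t) fun h => h.exists_hasSum_eval t
  obtain ⟨x, hx, -⟩ := exists_bump (isCompact_singleton (x := t))
  replace hx : x t = 1 := hx t rfl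
  obtain ⟨s, hs, hle⟩ := h x
  have hsupp : Function.support (fun j => evalUnitization t (frameTerm x (u j)))
      = {j | u j t ≠ 0} := by
    ext j
    simp [evalUnitization_frameTerm, hx]
  rw [evalUnitization_innerSelf, hx] at hle
  refine ⟨hsupp ▸ hs.summable.countable_support, ?_⟩
  rw [← hsupp, Function.support_nonempty_iff]
  intro h0
  rw [h0] at hs
  rw [hs.unique hasSum_zero] at hle
  have hle' : c ≤ 0 := by simpa using (Complex.le_def.1 hle).1
  linarith

/-- A noncompact space whose `σ`-compact sets are precompact admits no point-countable cover by
supports of functions vanishing at infinity on a space in which it is a closed subspace. -/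
theorem ClassIV.not_forall_countable_nonempty {P : Type*} [TopologicalSpace P] (hP : ClassIV P)
    {i : P → K} (hi : IsClosedEmbedding i) {J : Type*} (u : J → C₀(K, ℂ)) :
    ¬ ∀ t, {j | u j t ≠ 0}.Countable ∧ {j | u j t ≠ 0}.Nonempty := by
  intro hu
  have hsep : ∀ s : Finset P, (∀ p ∈ s, True) →
      ∃ q, True ∧ ∀ p ∈ s, ∀ j, u j (i p) ≠ 0 → u j (i q) = 0 := fun s _ => by
    -- Only countably many members are nonzero at some point of `s`; their supports cannot exhaust
    -- `P`.
    have hσ : IsSigmaCompact (⋃ p ∈ (s : Set P), ⋃ j ∈ {j | u j (i p) ≠ 0},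
        i ⁻¹' Function.support (u j)) :=
      isSigmaCompact_biUnion s.countable_toSet fun p _ =>
        isSigmaCompact_biUnion (hu (i p)).1 fun j _ =>
          (isSigmaCompact_support (u j)).preimage_isClosedEmbedding hi
    obtain ⟨q, hq⟩ := (ne_univ_iff_exists_notMem _).1 (hP.ne_univ_of_isSigmaCompact hσ)
    refine ⟨q, trivial, fun p hp j hj => ?_⟩
    by_contra hne
    exact hq (mem_biUnion (Finset.mem_coe.2 hp) (mem_biUnion (show j ∈ {j | _} from hj) hne))
  obtain ⟨p, -, hp⟩ := exists_seq_of_forall_finset_exists (fun _ : P => True) _ hsep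
  have hcompact : IsCompact (closure (range p)) :=
    hP.2.2.2 _ <| by
      rw [← iUnion_singleton_eq_range]
      exact isSigmaCompact_iUnion_of_isCompact _ fun _ => isCompact_singleton
  obtain ⟨q, -, hq⟩ := hcompact.exists_mapClusterPt (f := atTop) (u := p)
    (tendsto_principal.2 <| Eventually.of_forall fun n => subset_closure (mem_range_self n))
  obtain ⟨j, hj⟩ := (hu (i q)).2
  have hopen : {r : P | u j (i r) ≠ 0} ∈ 𝓝 q :=
    ((u j).1.continuous.comp hi.continuous).continuousAt.eventually_ne hj
  have hfreq := hq.frequently hopen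
  obtain ⟨m, -, hm⟩ := frequently_atTop.1 hfreq 0
  -- Starting at `m + 1` gives a strictly later term at which the same `u j` is nonzero.
  obtain ⟨n, hn, hn'⟩ := frequently_atTop.1 hfreq (m + 1)
  exact hn' (hp m n hn j hm)

end NoFrames

end CStarFrames

end

theorem mainTheorem6 {P₁ : Type*} {P₂ : Type*} [TopologicalSpace P₁] [TopologicalSpace P₂]
    (h₁ : CStarFrames.ClassIV P₁)
    (h₂ : CStarFrames.ClassI P₂ ∨ CStarFrames.ClassII P₂ ∨ CStarFrames.ClassIII P₂) :
    (¬ CompactSpace P₂ → CStarFrames.ClassIII (P₁ ⊕ P₂)) ∧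
    CStarFrames.IsAdjointable
      (CStarFrames.mulOperator (CStarFrames.indicatorInl P₁ P₂)) ∧
    ¬ CStarFrames.IsACompact
      (CStarFrames.mulOperator (CStarFrames.indicatorInl P₁ P₂)) ∧
    CStarFrames.IsOuterTotallyBounded
      (CStarFrames.mulOperator (CStarFrames.indicatorInl P₁ P₂) ''
        Metric.closedBall (0 : C₀(P₁ ⊕ P₂, ℂ)) 1) ∧
    ∀ (J : Type*) (x : J → C₀(P₁ ⊕ P₂, ℂ)), ¬ CStarFrames.IsFrame x := by
  have : LocallyCompactSpace P₁ := h₁.1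
  have : T2Space P₁ := h₁.2.1
  have : LocallyCompactSpace P₂ := by rcases h₂ with h | h | h <;> exact h.1
  have : T2Space P₂ := by rcases h₂ with h | h | h <;> exact h.2.1
  refine ⟨CStarFrames.classIII_sum h₁ h₂, CStarFrames.isAdjointable_mulOperator ?_,
    CStarFrames.not_isACompact_mulOperator_indicatorInl h₁,
    CStarFrames.isOuterTotallyBounded_image_indicatorInl h₁, fun J x hx => ?_⟩
  · rintro (t | t) <;> simp [CStarFrames.indicatorInl]
  · have := CStarFrames.locallyCompactSpace_sum (X := P₁) (Y := P₂)
    exact h₁.not_forall_countable_nonempty IsClosedEmbedding.inl x hx.support_countable_nonempty
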